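/- Let $(M,g)$ be a connected Lorentzian spin manifold, i.e. a connected smooth manifold of dimension $n$ with a smooth metric $g$ of signature $(-,+,\dots,+)$ that is space- and time-oriented and is equipped with a spin structure (for the group $\mathrm{Spin}^+(1,n-1)$). Let $\Sigma$ be its complex spinor bundle, with Clifford multiplication satisfying $X\cdot Y\cdot\varphi+Y\cdot X\cdot\varphi=-2g(X,Y)\varphi$, with the Hermitian bundle metric $\langle\cdot,\cdot\rangle$ (conjugate-linear in the second entry) induced by the $\mathrm{Spin}^+(1,n-1)$-invariant Hermitian form $\langle u,v\rangle=(e_0\cdot u,v)$ on the irreducible complex spinor module of dimension $2^{\lfloor n/2\rfloor}$ (here $e_0,\dots,e_{n-1}$ is the standard basis of Minkowski space with $e_0$ time-like, and $(\cdot,\cdot)$ is the standard positive definite Hermitian inner product, for which $e_0$ acts by a self-adjoint and $e_1,\dots,e_{n-1}$ by skew-adjoint endomorphisms), and with the lift $\nabla^\Sigma$ of the Levi-Civita connection $\nabla$ of $g$. Let $\varphi$ be a smooth parallel spinor field, $\nabla^\Sigma\varphi=0$, that is not identically zero. Then: 1. there is a unique (real) vector field $V_\varphi$ on $M$, the Dirac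 current of $\varphi$, such that $$g(V_\varphi,X)=i^{2}\langle\varphi,X\cdot\varphi\rangle=-\langle\varphi,X\cdot\varphi\rangle\qquad\text{for all } X\in TM,$$ and $V_\varphi$ is smooth; 2. $V_\varphi$ vanishes at no point of $M$; 3. $V_\varphi$ is parallel, $\nabla V_\varphi=0$; 4. $g(V_\varphi,V_\varphi)\le 0$ everywhere on $M$. In particular $V_\varphi$ is a causal parallel vector field. -/

import Mathlib

open scoped Manifold ContDiff

noncomputable section

namespace SpinLorentz

/-! ### The model: Minkowski space, its Clifford algebra, and the spinor module -/

/-- The signs `ε_a` of the Minkowski metric on `ℝ^(m+1)`: one minus sign, in position `0`. -/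
def sgn {m : ℕ} (a : Fin (m + 1)) : ℝ := if a = 0 then -1 else 1

/-- The quadratic form `v ↦ -η(v, v)`, where `η = diag(-1, 1, …, 1)`. Since Mathlib's Clifford
relation is `v * v = Q v`, this choice of `Q` gives the relation `v * w + w * v = -2 η(v, w)`. -/
def cliffordForm (m : ℕ) : QuadraticForm ℝ (Fin (m + 1) → ℝ) :=
  QuadraticMap.weightedSumSquares ℝ (fun a : Fin (m + 1) => -sgn a)

/-- The real Clifford algebra of Minkowski space. Its `spinGroup` (even products of
vectors that satisfy `x * star x = 1`) is the double cover of the group `SO⁺(1, m)` of Lorentz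
transformations that preserve both the space and the time orientation. -/
abbrev Cl (m : ℕ) : Type := CliffordAlgebra (cliffordForm m)

/-- The complex spinor module `Δ ≅ (ℂ²)^{⊗ k}`, `k = ⌊(m+1)/2⌋`, of complex dimension `2^k`, with
its standard positive definite inner product; basis vectors are labelled by `k` bits. -/
abbrev Spinor (m : ℕ) : Type := EuclideanSpace ℂ (Fin ((m + 1) / 2) → Bool)

/-- Negates the bit in position `j` (does nothing if there is no such position). -/
def flipBit {k : ℕ} (j : ℕ) (b : Fin k → Bool) : Fin k → Bool :=
  fun i => if i.val = j then !(b i) else b i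

/-- The sign `(-1)^(b_0 + … + b_{l-1})`. -/
def paritySign {k : ℕ} (l : ℕ) (b : Fin k → Bool) : ℂ :=
  ∏ i : Fin k, if i.val < l ∧ b i = true then -1 else 1

/-- The standard anticommuting Hermitian involutions on `(ℂ²)^{⊗ k}` in terms of Pauli matrices:
number `2j` is `Z ⊗ … ⊗ Z ⊗ X ⊗ 1 ⊗ … ⊗ 1` and number `2j+1` is `Z ⊗ … ⊗ Z ⊗ Y ⊗ 1 ⊗ … ⊗ 1`
up to a global sign, with `X`, `Y` in position `j`; for `m + 1` odd the last one is
`Z ⊗ … ⊗ Z`. -/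
def pauli (m : ℕ) (a : ℕ) : Module.End ℂ (Spinor m) where
  toFun u := WithLp.toLp 2 fun b =>
    Complex.I ^ (a % 2) * paritySign ((a + 1) / 2) b * u (flipBit (a / 2) b)
  map_add' u v := by ext b; simp [mul_add]
  map_smul' c u := by ext b; simp; ring

/-- The gamma matrices: `γ_0² = 1`, `γ_a² = -1` for `a ≥ 1`. -/
def gamma (m : ℕ) (a : Fin (m + 1)) : Module.End ℂ (Spinor m) :=
  if a = 0 then pauli m a else Complex.I • pauli m a

lemma flip_flip {k : ℕ} (j : ℕ) (b : Fin k → Bool) : flipBit j (flipBit j b) = b := by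
  funext i; by_cases h : i.val = j <;> simp [flipBit, h]

lemma flip_comm {k : ℕ} (j l : ℕ) (b : Fin k → Bool) : flipBit j (flipBit l b) = flipBit l (flipBit j b) := by
  funext i; simp only [flipBit]; split_ifs <;> rfl

lemma paritySign_mul_self {k : ℕ} (l : ℕ) (b : Fin k → Bool) :
    paritySign l b * paritySign l b = 1 := by
  rw [paritySign, ← Finset.prod_mul_distrib]
  exact Finset.prod_eq_one fun i _ => by split_ifs <;> simp

lemma paritySign_flip_of_le {k : ℕ} {l j : ℕ} (h : l ≤ j) (b : Fin k → Bool) :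
    paritySign l (flipBit j b) = paritySign l b := by
  refine Finset.prod_congr rfl fun i _ => ?_
  by_cases hi : i.val = j
  · have : ¬ i.val < l := by omega
    simp [this]
  · simp [flipBit, hi]

lemma paritySign_flip_of_lt {k : ℕ} {l j : ℕ} (hk : j < k) (h : j < l) (b : Fin k → Bool) :
    paritySign l (flipBit j b) = -paritySign l b := by
  unfold paritySign
  rw [← Finset.mul_prod_erase _ _ (Finset.mem_univ (⟨j, hk⟩ : Fin k)),
    ← Finset.mul_prod_erase _ (fun i : Fin k => if i.val < l ∧ b i = true then (-1 : ℂ) else 1)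
      (Finset.mem_univ (⟨j, hk⟩ : Fin k)), ← neg_mul]
  congr 1
  · cases hb : b ⟨j, hk⟩ <;> simp [flipBit, h, hb]
  · refine Finset.prod_congr rfl fun i hi => ?_
    have : i.val ≠ j := fun e => (Finset.mem_erase.1 hi).1 (Fin.ext e)
    simp [flipBit, this]

lemma pauli_sq (m : ℕ) {a : ℕ} (ha : a ≤ m) : pauli m a * pauli m a = 1 := by
  ext u b
  simp only [pauli, Module.End.mul_apply, LinearMap.coe_mk, AddHom.coe_mk, flip_flip,
    Module.End.one_apply]
  rcases Nat.even_or_odd' a with ⟨j, rfl | rfl⟩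
  · have h := paritySign_mul_self ((2 * j + 1) / 2) b
    rw [paritySign_flip_of_le (by omega), Nat.mul_mod_right]
    linear_combination u b * h
  · have h := paritySign_mul_self ((2 * j + 1 + 1) / 2) b
    rw [paritySign_flip_of_lt (by omega) (by omega), show (2 * j + 1) % 2 = 1 by omega]
    linear_combination u b * h - u b * paritySign ((2 * j + 1 + 1) / 2) b ^ 2 * Complex.I_sq

lemma pauli_anticomm (m : ℕ) {a c : ℕ} (hac : a < c) (hc : c ≤ m) :
    pauli m a * pauli m c + pauli m c * pauli m a = 0 := by
  ext u b
  simp only [pauli, Module.End.mul_apply, LinearMap.coe_mk, AddHom.coe_mk, LinearMap.add_apply,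
    PiLp.add_apply, LinearMap.zero_apply, PiLp.zero_apply]
  rw [paritySign_flip_of_lt (j := a / 2) (by omega) (by omega),
    paritySign_flip_of_le (j := c / 2) (by omega), flip_comm (c / 2)]
  ring

lemma gamma_sq (m : ℕ) (a : Fin (m + 1)) :
    gamma m a * gamma m a = algebraMap ℝ (Module.End ℂ (Spinor m)) (-sgn a) := by
  have h := pauli_sq m (Nat.lt_succ_iff.1 a.2)
  by_cases ha : a = 0
  · rw [gamma, if_pos ha, h, sgn, if_pos ha]; simp
  · rw [gamma, if_neg ha, smul_mul_smul_comm, h, sgn, if_neg ha]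
    ext u b; simp

lemma gamma_anticomm (m : ℕ) {a c : Fin (m + 1)} (hac : a ≠ c) :
    gamma m a * gamma m c + gamma m c * gamma m a = 0 := by
  have key : pauli m a * pauli m c + pauli m c * pauli m a = 0 := by
    rcases lt_or_gt_of_ne (fun e => hac (Fin.ext e) : a.val ≠ c.val) with h | h
    · exact pauli_anticomm m h (Nat.lt_succ_iff.1 c.2)
    · rw [add_comm (pauli m a * pauli m c)]; exact pauli_anticomm m h (Nat.lt_succ_iff.1 a.2)
  have hx (x : Fin (m + 1)) : ∃ z : ℂ, gamma m x = z • pauli m x := by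
    by_cases h : x = 0
    · exact ⟨1, by rw [gamma, if_pos h, one_smul]⟩
    · exact ⟨Complex.I, by rw [gamma, if_neg h]⟩
  obtain ⟨z, hz⟩ := hx a
  obtain ⟨w, hw⟩ := hx c
  rw [hz, hw, smul_mul_smul_comm, smul_mul_smul_comm, mul_comm w z, ← smul_add, key, smul_zero]

/-- Clifford multiplication of spinors by vectors of Minkowski space: `v ↦ ∑ v_a γ_a`. -/
def gammaMap (m : ℕ) : (Fin (m + 1) → ℝ) →ₗ[ℝ] Module.End ℂ (Spinor m) :=
  Fintype.linearCombination ℝ (gamma m)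

lemma gammaMap_sq (m : ℕ) (v : Fin (m + 1) → ℝ) :
    gammaMap m v * gammaMap m v =
      algebraMap ℝ (Module.End ℂ (Spinor m)) (cliffordForm m v) := by
  have h1 : gammaMap m v * gammaMap m v =
      ∑ a, ∑ c, (v a * v c) • (gamma m a * gamma m c) := by
    simp only [gammaMap, Fintype.linearCombination_apply, Finset.sum_mul_sum,
      smul_mul_smul_comm]
  have h2 : gammaMap m v * gammaMap m v =
      ∑ a, ∑ c, (v a * v c) • (gamma m c * gamma m a) := by
    rw [h1, Finset.sum_comm]
    exact Finset.sum_congr rfl fun a _ => Finset.sum_congr rfl fun c _ => by rw [mul_comm (v c)]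
  have h3 : (2 : ℝ) • (gammaMap m v * gammaMap m v) =
      (2 : ℝ) • algebraMap ℝ (Module.End ℂ (Spinor m)) (cliffordForm m v) := by
    rw [two_smul]
    nth_rewrite 1 [h1]
    rw [h2, ← Finset.sum_add_distrib]
    have h5 (a : Fin (m + 1)) : ∑ c, (v a * v c) • (gamma m a * gamma m c) +
        ∑ c, (v a * v c) • (gamma m c * gamma m a) =
        ∑ c, (v a * v c) • (gamma m a * gamma m c + gamma m c * gamma m a) := by
      rw [← Finset.sum_add_distrib]
      simp only [smul_add]
    have h4 (a : Fin (m + 1)) : ∑ c, (v a * v c) • (gamma m a * gamma m c + gamma m c * gamma m a)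
        = (2 : ℝ) • algebraMap ℝ (Module.End ℂ (Spinor m)) (-sgn a * (v a * v a)) := by
      rw [Finset.sum_eq_single a]
      · rw [gamma_sq, ← two_smul ℝ, smul_comm, map_mul, ← Algebra.commutes, ← Algebra.smul_def]
      · intro c _ hc
        rw [gamma_anticomm m hc.symm, smul_zero]
      · simp
    simp only [h5, h4, ← Finset.smul_sum, ← map_sum]
    simp [cliffordForm, QuadraticMap.weightedSumSquares_apply]
  exact smul_right_injective _ (two_ne_zero (α := ℝ)) h3

/-- The complex spin representation: the irreducible action of the Clifford algebra on `Δ`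
extending `e_a ↦ γ_a`. -/
def spinRep (m : ℕ) : Cl m →ₐ[ℝ] Module.End ℂ (Spinor m) :=
  CliffordAlgebra.lift (cliffordForm m) ⟨gammaMap m, gammaMap_sq m⟩

/-- The `Spin⁺`-invariant Hermitian form `⟨u, v⟩ = (γ_0 u, v)` on `Δ`, conjugate-linear in `v`;
it is indefinite of neutral signature for `m ≥ 1`. -/
def spinForm {m : ℕ} (u v : Spinor m) : ℂ := inner ℂ v (gamma m 0 u)

/-! ### Lorentzian manifolds and the Levi-Civita connection -/

/-- A smooth Lorentzian metric of signature `(-, +, …, +)` on a manifold of dimension `m + 1`. -/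
structure LorentzianMetric (m : ℕ) (M : Type*) [TopologicalSpace M]
    [ChartedSpace (EuclideanSpace ℝ (Fin (m + 1))) M] [IsManifold (𝓡 (m + 1)) ∞ M] where
  val : ∀ x : M, TangentSpace (𝓡 (m + 1)) x →L[ℝ] TangentSpace (𝓡 (m + 1)) x →L[ℝ] ℝ
  symm : ∀ (x : M) (X Y : TangentSpace (𝓡 (m + 1)) x), val x X Y = val x Y X
  exists_orthonormal : ∀ x : M,
    ∃ b : Module.Basis (Fin (m + 1)) ℝ (TangentSpace (𝓡 (m + 1)) x),
      ∀ a c, val x (b a) (b c) = if a = c then sgn a else 0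
  contMDiff : ContMDiff (𝓡 (m + 1))
    ((𝓡 (m + 1)).prod 𝓘(ℝ, EuclideanSpace ℝ (Fin (m + 1)) →L[ℝ]
      EuclideanSpace ℝ (Fin (m + 1)) →L[ℝ] ℝ)) ∞
    (fun x => Bundle.TotalSpace.mk' (EuclideanSpace ℝ (Fin (m + 1)) →L[ℝ]
      EuclideanSpace ℝ (Fin (m + 1)) →L[ℝ] ℝ)
      (E := fun x : M => TangentSpace (𝓡 (m + 1)) x →L[ℝ] TangentSpace (𝓡 (m + 1)) x →L[ℝ] ℝ)
      x (val x))

section Manifold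

variable {m : ℕ} {M : Type*} [TopologicalSpace M]
  [ChartedSpace (EuclideanSpace ℝ (Fin (m + 1))) M] [IsManifold (𝓡 (m + 1)) ∞ M]

/-- The type of connections on the tangent bundle. In Mathlib's notation `∇ Y x X` is the value
at `x` of `∇_X Y`. -/
abbrev Connection (m : ℕ) (M : Type*) [TopologicalSpace M]
    [ChartedSpace (EuclideanSpace ℝ (Fin (m + 1))) M] [IsManifold (𝓡 (m + 1)) ∞ M] :=
  CovariantDerivative (𝓡 (m + 1)) (EuclideanSpace ℝ (Fin (m + 1)))
    (TangentSpace (𝓡 (m + 1)) : M → Type _)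

/-- `∇` is the Levi-Civita connection of `g`: it is torsion-free and metric. -/
structure IsLeviCivita (g : LorentzianMetric m M) (nabla : Connection m M) : Prop where
  torsion_eq_zero : nabla.torsion = 0
  metric : ∀ (Y Z : ∀ x : M, TangentSpace (𝓡 (m + 1)) x) (x : M),
    MDifferentiableAt (𝓡 (m + 1)) (𝓡 (m + 1)).tangent
      (fun y => (⟨y, Y y⟩ : TangentBundle (𝓡 (m + 1)) M)) x →
    MDifferentiableAt (𝓡 (m + 1)) (𝓡 (m + 1)).tangent
      (fun y => (⟨y, Z y⟩ : TangentBundle (𝓡 (m + 1)) M)) x →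
    ∀ X : TangentSpace (𝓡 (m + 1)) x,
      mvfderiv (𝓡 (m + 1)) (fun y => g.val y (Y y) (Z y)) x X =
        g.val x (nabla Y x X) (Z x) + g.val x (Y x) (nabla Z x X)

/-- The components `(ε_a g(X, e_a))_a` of a tangent vector with respect to an orthonormal frame. -/
def components (g : LorentzianMetric m M) {x : M}
    (e : Fin (m + 1) → TangentSpace (𝓡 (m + 1)) x) (X : TangentSpace (𝓡 (m + 1)) x) :
    Fin (m + 1) → ℝ :=
  fun a => sgn a * g.val x X (e a)

/-! ### Spin structures, spinor fields, the spin connection -/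

/-- A spin structure on a space- and time-oriented Lorentzian manifold, given by trivialisations
and transition functions: an open cover `U i`, smooth orthonormal frames over the `U i`, and
smooth `Spin⁺`-valued functions `h i j` on the overlaps that satisfy the cocycle condition and
cover the changes of frame. As the frames differ by elements of `SO⁺(1, m)`, they determine the
space and the time orientation. -/
structure SpinStructure (g : LorentzianMetric m M) (ι : Type*) where
  U : ι → Set M
  isOpen_U : ∀ i, IsOpen (U i)
  exists_mem_U : ∀ x, ∃ i, x ∈ U i
  frame : ι → Fin (m + 1) → ∀ x : M, TangentSpace (𝓡 (m + 1)) x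
  contMDiffOn_frame : ∀ i a, ContMDiffOn (𝓡 (m + 1)) (𝓡 (m + 1)).tangent ∞
    (fun x => (⟨x, frame i a x⟩ : TangentBundle (𝓡 (m + 1)) M)) (U i)
  orthonormal : ∀ i, ∀ x ∈ U i, ∀ a c,
    g.val x (frame i a x) (frame i c x) = if a = c then sgn a else 0
  h : ι → ι → M → Cl m
  mem_spin : ∀ i j, ∀ x ∈ U i ∩ U j, h i j x ∈ spinGroup (cliffordForm m)
  /-- Smoothness of a map into the finite-dimensional algebra `Cl m`, tested on coordinates. -/
  contMDiffOn_h : ∀ i j (f : Module.Dual ℝ (Cl m)),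
    ContMDiffOn (𝓡 (m + 1)) 𝓘(ℝ, ℝ) ∞ (fun x => f (h i j x)) (U i ∩ U j)
  cocycle : ∀ i j k, ∀ x ∈ U i ∩ U j ∩ U k, h i j x * h j k x = h i k x
  /-- The double cover `λ(s) v = s v s⁻¹` sends `h i j` to the change of components from the
  frame `j` to the frame `i`. -/
  covers : ∀ i j, ∀ x ∈ U i ∩ U j, ∀ X : TangentSpace (𝓡 (m + 1)) x,
    h i j x * CliffordAlgebra.ι (cliffordForm m) (components g (fun a => frame j a x) X) =
      CliffordAlgebra.ι (cliffordForm m) (components g (fun a => frame i a x) X) * h i j x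

variable {g : LorentzianMetric m M} {ι : Type*}

/-- A spinor field, i.e. a smooth section of the spinor bundle `Σ` associated with the spin
structure by the spin representation: smooth local functions `φ i : U i → Δ` with
`φ i = ρ(h i j) φ j` on the overlaps. The values of `φ i` outside `U i` are irrelevant. -/
structure SpinorField (S : SpinStructure g ι) where
  toFun : ι → M → Spinor m
  contMDiffOn : ∀ i, ContMDiffOn (𝓡 (m + 1)) 𝓘(ℝ, Spinor m) ∞ (toFun i) (S.U i)
  compatible : ∀ i j, ∀ x ∈ S.U i ∩ S.U j, toFun i x = spinRep m (S.h i j x) (toFun j x)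

namespace SpinorField

variable {S : SpinStructure g ι}

/-- Clifford multiplication `X · φ` at a point of `U i`, expressed in the trivialisation `i`. -/
def clifford (φ : SpinorField S) (i : ι) (x : M) (X : TangentSpace (𝓡 (m + 1)) x) : Spinor m :=
  spinRep m (CliffordAlgebra.ι (cliffordForm m) (components g (fun a => S.frame i a x) X))
    (φ.toFun i x)

/-- The lift `∇^Σ_X φ` of the connection `∇` to the spinor bundle, expressed in the
trivialisation `i`: `X(φ) + (1/4) ∑_{a,c} ε_a ε_c g(∇_X e_a, e_c) γ_a γ_c φ`. -/
def covDeriv (nabla : Connection m M) (φ : SpinorField S) (i : ι) (x : M)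
    (X : TangentSpace (𝓡 (m + 1)) x) : Spinor m :=
  mvfderiv (𝓡 (m + 1)) (φ.toFun i) x X +
    (1 / 4 : ℝ) • ∑ a, ∑ c,
      (sgn a * sgn c * g.val x (nabla (S.frame i a) x X) (S.frame i c x)) •
        gamma m a (gamma m c (φ.toFun i x))

/-- `φ` is a parallel spinor field: `∇^Σ φ = 0`. -/
def IsParallel (nabla : Connection m M) (φ : SpinorField S) : Prop :=
  ∀ i, ∀ x ∈ S.U i, ∀ X : TangentSpace (𝓡 (m + 1)) x, φ.covDeriv nabla i x X = 0

/-- `φ` is not the zero section. -/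
def IsNontrivial (φ : SpinorField S) : Prop := ∃ i, ∃ x ∈ S.U i, φ.toFun i x ≠ 0

/-- `V` is the Dirac current of `φ`: `g(V, X) = i^(r+1) ⟨φ, X · φ⟩` for all `X`, where `r = 1` is
the number of negative eigenvalues of `g`. -/
def IsDiracCurrent (φ : SpinorField S) (V : ∀ x : M, TangentSpace (𝓡 (m + 1)) x) : Prop :=
  ∀ i, ∀ x ∈ S.U i, ∀ X : TangentSpace (𝓡 (m + 1)) x,
    ((g.val x (V x) X : ℝ) : ℂ) =
      Complex.I ^ (1 + 1) * spinForm (φ.toFun i x) (φ.clifford i x X)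

end SpinorField

end Manifold

end SpinLorentz

end

open scoped Manifold ContDiff

noncomputable section

namespace SpinLorentz

section

/-! ### The spinor form and the Clifford algebra -/

/-! Write V in a local orthonormal frame, with components -ε_a⟨φ, γ_a φ⟩. Every γ_a is symmetric for
the spinor form, so reversal in the Clifford algebra is the adjoint (`spinForm_spinRep_left`). Hence
the components are real and the form is `Spin⁺`-invariant, so the local expressions agree on
overlaps. The zeroth component is ‖φ‖², so V vanishes only where φ does, and Cauchy-Schwarz bounds
the spatial part by ‖φ‖², so V is causal. If φ is parallel, then dφ = -Aφ with A = (1/4)∑ θ_{ac} γ_a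
γ_c. As A is skew for the form and [γ_c, A] reproduces the connection on vectors, d⟨φ, γ_c φ⟩
accounts for all of g(V, ∇e_c), which leaves g(∇V, e_c) = 0. Finally, A is locally bounded, so ‖dφ‖
≤ C‖φ‖ near each zero and the zero set of φ is open. It is also closed, hence empty by
connectedness. -/

lemma inner_pauli_left (m : ℕ) {a : ℕ} (ha : a ≤ m) (u v : Spinor m) :
    inner ℂ (pauli m a u) v = inner ℂ u (pauli m a v) := by
  simp only [PiLp.inner_apply, pauli, LinearMap.coe_mk, AddHom.coe_mk, RCLike.inner_apply,
    map_mul, map_pow]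
  have hp (l : ℕ) (b : Fin ((m + 1) / 2) → Bool) :
      (starRingEnd ℂ) (paritySign l b) = paritySign l b := by
    rw [paritySign, map_prod]
    exact Finset.prod_congr rfl fun i _ => by split_ifs <;> simp
  let e : Equiv.Perm (Fin ((m + 1) / 2) → Bool) :=
    ⟨flipBit (a / 2), flipBit (a / 2), flip_flip _, flip_flip _⟩
  -- Reindexing one side moves the bit flip to the other argument. For odd `a`, the sign from
  -- conjugating `I` cancels the sign change of `paritySign`.
  rw [← Equiv.sum_comp e]
  refine Finset.sum_congr rfl fun b _ => ?_
  simp only [e, Equiv.coe_fn_mk, flip_flip, hp, Complex.conj_I]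
  rcases Nat.even_or_odd' a with ⟨j, rfl | rfl⟩
  · rw [paritySign_flip_of_le (by omega), Nat.mul_mod_right]
    ring
  · rw [paritySign_flip_of_lt (by omega) (by omega), show (2 * j + 1) % 2 = 1 by omega]
    ring

lemma inner_gamma_zero_left (m : ℕ) (u v : Spinor m) :
    inner ℂ (gamma m 0 u) v = inner ℂ u (gamma m 0 v) := by
  simpa [gamma] using inner_pauli_left m (Nat.zero_le m) u v

lemma inner_gamma_left {m : ℕ} {a : Fin (m + 1)} (ha : a ≠ 0) (u v : Spinor m) :
    inner ℂ (gamma m a u) v = -inner ℂ u (gamma m a v) := by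
  simp [gamma, ha, inner_pauli_left m (Nat.lt_succ_iff.1 a.2) u v, mul_comm]

lemma gamma_zero_gamma_zero {m : ℕ} (u : Spinor m) : gamma m 0 (gamma m 0 u) = u := by
  have h := LinearMap.congr_fun (gamma_sq m 0) u
  simpa [sgn] using h

lemma norm_gamma_zero {m : ℕ} (u : Spinor m) : ‖gamma m 0 u‖ = ‖u‖ := by
  have h : inner ℂ (gamma m 0 u) (gamma m 0 u) = inner ℂ u u := by
    rw [inner_gamma_zero_left, gamma_zero_gamma_zero]
  rw [inner_self_eq_norm_sq_to_K, inner_self_eq_norm_sq_to_K] at h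
  exact (sq_eq_sq₀ (norm_nonneg _) (norm_nonneg _)).1 (by exact_mod_cast h)

/-- For `a ≠ 0` two signs cancel: γ_a is skew for the positive inner product and anticommutes with
γ_0. -/
lemma spinForm_gamma_left {m : ℕ} (a : Fin (m + 1)) (u v : Spinor m) :
    spinForm (gamma m a u) v = spinForm u (gamma m a v) := by
  unfold spinForm
  by_cases ha : a = 0
  · subst ha
    rw [inner_gamma_zero_left]
  · have h := LinearMap.congr_fun (gamma_anticomm m ha) u
    simp only [LinearMap.add_apply, Module.End.mul_apply, LinearMap.zero_apply] at h
    rw [inner_gamma_left ha, eq_neg_of_add_eq_zero_right h, inner_neg_right]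

lemma spinForm_add_left {m : ℕ} (u v w : Spinor m) :
    spinForm (u + v) w = spinForm u w + spinForm v w := by
  simp [spinForm]

lemma spinForm_add_right {m : ℕ} (u v w : Spinor m) :
    spinForm u (v + w) = spinForm u v + spinForm u w := by
  simp [spinForm]

lemma spinForm_smul_left {m : ℕ} (r : ℝ) (u v : Spinor m) :
    spinForm (r • u) v = r * spinForm u v := by
  have h : (r • u) = (r : ℂ) • u := by ext b; simp
  simp only [spinForm, h, map_smul, inner_smul_right]

lemma spinForm_smul_right {m : ℕ} (r : ℝ) (u v : Spinor m) :
    spinForm u (r • v) = r * spinForm u v := by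
  have h : (r • v) = (r : ℂ) • v := by ext b; simp
  simp only [spinForm, h, inner_smul_left, Complex.conj_ofReal]

lemma spinForm_conj {m : ℕ} (u v : Spinor m) : (starRingEnd ℂ) (spinForm u v) = spinForm v u := by
  rw [spinForm, spinForm, inner_conj_symm, inner_gamma_zero_left]

lemma spinForm_sum_left {m : ℕ} {κ : Type*} (s : Finset κ) (u : κ → Spinor m) (v : Spinor m) :
    spinForm (∑ k ∈ s, u k) v = ∑ k ∈ s, spinForm (u k) v := by
  simp [spinForm]

lemma spinForm_sum_right {m : ℕ} {κ : Type*} (s : Finset κ) (u : Spinor m) (v : κ → Spinor m) :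
    spinForm u (∑ k ∈ s, v k) = ∑ k ∈ s, spinForm u (v k) := by
  simp [spinForm]

lemma gammaMap_apply {m : ℕ} (v : Fin (m + 1) → ℝ) (u : Spinor m) :
    gammaMap m v u = ∑ a, v a • gamma m a u := by
  simp [gammaMap, Fintype.linearCombination_apply, LinearMap.sum_apply]

lemma gammaMap_single {m : ℕ} (a : Fin (m + 1)) : gammaMap m (Pi.single a 1) = gamma m a := by
  simp [gammaMap, Fintype.linearCombination_apply_single]

lemma spinRep_ι {m : ℕ} (v : Fin (m + 1) → ℝ) :
    spinRep m (CliffordAlgebra.ι (cliffordForm m) v) = gammaMap m v := by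
  simp [spinRep]

/-- Reversal of products is the adjoint with respect to the spinor form. -/
lemma spinForm_spinRep_left {m : ℕ} (x : Cl m) (u v : Spinor m) :
    spinForm (spinRep m x u) v = spinForm u (spinRep m (CliffordAlgebra.reverse x) v) := by
  induction x using CliffordAlgebra.induction generalizing u v with
  | algebraMap r => simp [Module.algebraMap_end_apply, spinForm_smul_left, spinForm_smul_right]
  | ι w =>
    simp only [CliffordAlgebra.reverse_ι, spinRep_ι, gammaMap_apply, spinForm_sum_left,
      spinForm_sum_right, spinForm_smul_left, spinForm_smul_right, spinForm_gamma_left]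
  | mul x y hx hy => simp [hx, hy]
  | add x y hx hy => simp [hx, hy, spinForm_add_left, spinForm_add_right]

/-- Spin elements are even, so the grade involution contained in `star` fixes them. -/
lemma star_eq_reverse_of_mem_spinGroup {m : ℕ} {s : Cl m} (hs : s ∈ spinGroup (cliffordForm m)) :
    star s = CliffordAlgebra.reverse s := by
  rw [CliffordAlgebra.star_def, spinGroup.involute_eq hs]

/-- The spinor form is `Spin⁺`-invariant. -/
lemma spinForm_spinRep_of_mem_spinGroup {m : ℕ} {s : Cl m}
    (hs : s ∈ spinGroup (cliffordForm m)) (u v : Spinor m) :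
    spinForm (spinRep m s u) (spinRep m s v) = spinForm u v := by
  rw [spinForm_spinRep_left, ← star_eq_reverse_of_mem_spinGroup hs, ← Module.End.mul_apply,
    ← map_mul, spinGroup.star_mul_self_of_mem hs, map_one, Module.End.one_apply]

lemma spinForm_gammaMap_left {m : ℕ} (v : Fin (m + 1) → ℝ) (u w : Spinor m) :
    spinForm (gammaMap m v u) w = spinForm u (gammaMap m v w) := by
  simpa [spinRep_ι] using spinForm_spinRep_left (CliffordAlgebra.ι (cliffordForm m) v) u w

/-- A symmetric operator for a Hermitian form has real expectation values; this makes the current a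
real vector. -/
lemma spinForm_gammaMap_im {m : ℕ} (v : Fin (m + 1) → ℝ) (u : Spinor m) :
    (spinForm u (gammaMap m v u)).im = 0 := by
  rw [← Complex.conj_eq_iff_im, spinForm_conj, spinForm_gammaMap_left]

/-- γ_0 enters twice, once through the form, so the positive definite product of γ_0 u with itself
appears. -/
lemma spinForm_gamma_zero_self {m : ℕ} (u : Spinor m) :
    spinForm u (gamma m 0 u) = ((‖u‖ ^ 2 : ℝ) : ℂ) := by
  rw [spinForm, inner_self_eq_norm_sq_to_K, norm_gamma_zero]
  norm_cast

lemma cliffordForm_apply {m : ℕ} (v : Fin (m + 1) → ℝ) :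
    cliffordForm m v = -∑ a, sgn a * v a ^ 2 := by
  simp [cliffordForm, QuadraticMap.weightedSumSquares_apply, sq]

/-- Clifford multiplication by a space-like vector `v` with `v₀ = 0` scales norms by `|v|`. -/
lemma norm_gammaMap_sq {m : ℕ} {v : Fin (m + 1) → ℝ} (hv : v 0 = 0) (u : Spinor m) :
    ‖gammaMap m v u‖ ^ 2 = (∑ a, v a ^ 2) * ‖u‖ ^ 2 := by
  have hskew (w : Spinor m) : inner ℂ (gammaMap m v u) w = -inner ℂ u (gammaMap m v w) := by
    simp only [gammaMap_apply, sum_inner, inner_sum, ← Finset.sum_neg_distrib]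
    refine Finset.sum_congr rfl fun a _ => ?_
    by_cases ha : a = 0
    · simp [ha, hv]
    · rw [inner_smul_left_eq_smul, inner_smul_right_eq_smul, inner_gamma_left ha, smul_neg]
  have hsq : gammaMap m v (gammaMap m v u) = (-∑ a, v a ^ 2) • u := by
    have h := LinearMap.congr_fun (gammaMap_sq m v) u
    rw [Module.End.mul_apply, Module.algebraMap_end_apply, cliffordForm_apply] at h
    rw [h]
    congr 2
    refine Finset.sum_congr rfl fun a _ => ?_
    by_cases ha : a = 0
    · simp [ha, hv]
    · simp [sgn, ha]
  have h := hskew (gammaMap m v u)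
  rw [hsq, inner_smul_right_eq_smul, inner_self_eq_norm_sq_to_K, inner_self_eq_norm_sq_to_K,
    ← neg_smul, neg_neg, Complex.real_smul] at h
  apply Complex.ofReal_injective
  push_cast
  simpa using h

/-- The current of a spinor, as a vector of Minkowski space, is causal. -/
lemma sum_sgn_mul_sq_nonpos {m : ℕ} (u : Spinor m) (v : Fin (m + 1) → ℝ)
    (hv : ∀ a, v a = -(sgn a * (spinForm u (gamma m a u)).re)) : ∑ a, sgn a * v a ^ 2 ≤ 0 := by
  have h0 : v 0 = ‖u‖ ^ 2 := by
    rw [hv, spinForm_gamma_zero_self, Complex.ofReal_re]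
    simp [sgn]
  -- The spatial part of `v`. Its squared length `N` is -⟨u, n · u⟩, since `v` is itself built from
  -- these pairings.
  set n : Fin (m + 1) → ℝ := fun a => if a = 0 then 0 else v a with hn
  have hsplit : ∑ a, sgn a * v a ^ 2 = -(v 0) ^ 2 + ∑ a, n a ^ 2 := by
    simp [Fin.sum_univ_succ, hn, sgn]
  set N := ∑ a, n a ^ 2 with hN
  have hN0 : 0 ≤ N := Finset.sum_nonneg fun a _ => sq_nonneg _
  have hNre : N = -(spinForm u (gammaMap m n u)).re := by
    rw [gammaMap_apply, spinForm_sum_right, Complex.re_sum, ← Finset.sum_neg_distrib]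
    refine Finset.sum_congr rfl fun a _ => ?_
    rw [spinForm_smul_right, Complex.re_ofReal_mul]
    by_cases ha : a = 0
    · simp [hn, ha]
    · simp only [hn, ha, if_false]
      rw [hv a]
      simp only [sgn, ha, if_false]
      ring
  have hle : N ≤ ‖gammaMap m n u‖ * ‖u‖ := by
    rw [hNre, ← norm_gamma_zero u]
    calc -(spinForm u (gammaMap m n u)).re ≤ |(spinForm u (gammaMap m n u)).re| := neg_le_abs _
      _ ≤ ‖spinForm u (gammaMap m n u)‖ := Complex.abs_re_le_norm _
      _ ≤ _ := norm_inner_le_norm _ _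
  have hsq : N ^ 2 ≤ N * (‖u‖ ^ 2) ^ 2 := by
    calc N ^ 2 ≤ (‖gammaMap m n u‖ * ‖u‖) ^ 2 := pow_le_pow_left₀ hN0 hle 2
      _ = N * (‖u‖ ^ 2) ^ 2 := by rw [mul_pow, norm_gammaMap_sq (by simp [hn])]; ring
  rw [hsplit, h0]
  -- Cancelling `N` in `N² ≤ N‖u‖⁴` needs `N > 0`.
  rcases hN0.eq_or_lt with h | h
  · rw [← h]; nlinarith [sq_nonneg (‖u‖ ^ 2)]
  · have : N ≤ (‖u‖ ^ 2) ^ 2 := le_of_mul_le_mul_left (by rwa [← sq]) h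
    linarith

end

section

variable {m : ℕ} {M : Type*} [TopologicalSpace M]
  [ChartedSpace (EuclideanSpace ℝ (Fin (m + 1))) M] [IsManifold (𝓡 (m + 1)) ∞ M]

/-! ### Orthonormal frames and the Dirac current -/

lemma sgn_mul_sgn {m : ℕ} (a : Fin (m + 1)) : sgn a * sgn a = 1 := by
  unfold sgn; split_ifs <;> norm_num

lemma components_apply_frame (g : LorentzianMetric m M) {x : M}
    {e : Fin (m + 1) → TangentSpace (𝓡 (m + 1)) x}
    (he : ∀ a c, g.val x (e a) (e c) = if a = c then sgn a else 0) (c : Fin (m + 1)) :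
    components g e (e c) = Pi.single c 1 := by
  funext a
  rw [components, he]
  by_cases h : c = a
  · subst h; simp [sgn_mul_sgn]
  · simp [h, Ne.symm h]

lemma metric_sum_smul_left (g : LorentzianMetric m M) {x : M}
    (e : Fin (m + 1) → TangentSpace (𝓡 (m + 1)) x) (v : Fin (m + 1) → ℝ)
    (X : TangentSpace (𝓡 (m + 1)) x) :
    g.val x (∑ a, v a • e a) X = ∑ a, v a * g.val x (e a) X := by
  simp [map_sum]

lemma components_sum_smul (g : LorentzianMetric m M) {x : M}
    {e : Fin (m + 1) → TangentSpace (𝓡 (m + 1)) x}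
    (he : ∀ a c, g.val x (e a) (e c) = if a = c then sgn a else 0) (v : Fin (m + 1) → ℝ) :
    components g e (∑ a, v a • e a) = v := by
  funext c
  rw [components, metric_sum_smul_left]
  simp only [he, mul_ite, mul_zero, Finset.sum_ite_eq', Finset.mem_univ, if_true]
  linear_combination v c * sgn_mul_sgn c

/-- Taking components recovers the coefficients of a combination of the frame, so the frame is
independent, and by dimension it spans. -/
lemma sum_components_smul (g : LorentzianMetric m M) {x : M}
    {e : Fin (m + 1) → TangentSpace (𝓡 (m + 1)) x}
    (he : ∀ a c, g.val x (e a) (e c) = if a = c then sgn a else 0)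
    (X : TangentSpace (𝓡 (m + 1)) x) : ∑ a, components g e X a • e a = X := by
  have hli : LinearIndependent ℝ e := by
    rw [Fintype.linearIndependent_iff]
    intro v hv a
    have h := components_sum_smul g he v
    rw [hv] at h
    rw [← h]
    simp [components]
  have : FiniteDimensional ℝ (TangentSpace (𝓡 (m + 1)) x) :=
    inferInstanceAs (FiniteDimensional ℝ (EuclideanSpace ℝ (Fin (m + 1))))
  have hcard : Fintype.card (Fin (m + 1)) =
      Module.finrank ℝ (TangentSpace (𝓡 (m + 1)) x) :=
    (Fintype.card_fin _).trans (finrank_euclideanSpace_fin (𝕜 := ℝ) (n := m + 1)).symm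
  have hX : X ∈ Submodule.span ℝ (Set.range e) := by
    rw [hli.span_eq_top_of_card_eq_finrank' hcard]
    trivial
  obtain ⟨v, rfl⟩ := (Submodule.mem_span_range_iff_exists_fun ℝ).1 hX
  rw [components_sum_smul g he]

lemma eq_of_metric_frame_eq (g : LorentzianMetric m M) {x : M}
    {e : Fin (m + 1) → TangentSpace (𝓡 (m + 1)) x}
    (he : ∀ a c, g.val x (e a) (e c) = if a = c then sgn a else 0)
    {X Y : TangentSpace (𝓡 (m + 1)) x} (h : ∀ a, g.val x X (e a) = g.val x Y (e a)) : X = Y := by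
  rw [← sum_components_smul g he X, ← sum_components_smul g he Y]
  simp only [components, h]

/-- The components of the current `-⟨u, γ_a u⟩` of a spinor, with the index raised. -/
def currentComponents (u : Spinor m) (a : Fin (m + 1)) : ℝ :=
  -(sgn a * (spinForm u (gamma m a u)).re)

lemma currentComponents_zero (u : Spinor m) : currentComponents u 0 = ‖u‖ ^ 2 := by
  rw [currentComponents, spinForm_gamma_zero_self, Complex.ofReal_re]
  simp [sgn]

namespace SpinorField

variable {g : LorentzianMetric m M} {ι : Type*} {S : SpinStructure g ι} (φ : SpinorField S)

lemma clifford_eq_gammaMap (i : ι) (x : M) (X : TangentSpace (𝓡 (m + 1)) x) :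
    φ.clifford i x X = gammaMap m (components g (fun a => S.frame i a x) X) (φ.toFun i x) := by
  rw [clifford, spinRep_ι]

lemma clifford_frame {i : ι} {x : M} (hx : x ∈ S.U i) (a : Fin (m + 1)) :
    φ.clifford i x (S.frame i a x) = gamma m a (φ.toFun i x) := by
  rw [clifford_eq_gammaMap,
    components_apply_frame g (e := fun a => S.frame i a x) (S.orthonormal i x hx), gammaMap_single]

lemma clifford_compatible {i j : ι} {x : M} (hx : x ∈ S.U i ∩ S.U j)
    (X : TangentSpace (𝓡 (m + 1)) x) :
    φ.clifford i x X = spinRep m (S.h i j x) (φ.clifford j x X) := by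
  rw [clifford, clifford, φ.compatible i j x hx, ← Module.End.mul_apply, ← map_mul,
    ← S.covers i j x hx X, map_mul, Module.End.mul_apply]

/-- The transition function carries both entries along, and the form is invariant: the condition
defining the current does not depend on the trivialisation. -/
lemma spinForm_clifford_compatible {i j : ι} {x : M} (hx : x ∈ S.U i ∩ S.U j)
    (X : TangentSpace (𝓡 (m + 1)) x) :
    spinForm (φ.toFun i x) (φ.clifford i x X) = spinForm (φ.toFun j x) (φ.clifford j x X) := by
  rw [φ.compatible i j x hx, φ.clifford_compatible hx,
    spinForm_spinRep_of_mem_spinGroup (S.mem_spin i j x hx)]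

/-- Both sides are the same linear combination of the numbers g(X, e_a), so orthonormality plays no
role here. -/
lemma metric_current (i : ι) (x : M) (X : TangentSpace (𝓡 (m + 1)) x) :
    ((g.val x (∑ a, currentComponents (φ.toFun i x) a • S.frame i a x) X : ℝ) : ℂ) =
      Complex.I ^ (1 + 1) * spinForm (φ.toFun i x) (φ.clifford i x X) := by
  rw [clifford_eq_gammaMap]
  apply Complex.ext
  · rw [Complex.ofReal_re, metric_sum_smul_left, gammaMap_apply, spinForm_sum_right,
      one_add_one_eq_two, Complex.I_sq, neg_one_mul, Complex.neg_re, Complex.re_sum,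
      ← Finset.sum_neg_distrib]
    refine Finset.sum_congr rfl fun a _ => ?_
    rw [spinForm_smul_right, Complex.re_ofReal_mul, components, currentComponents, g.symm]
    ring
  · rw [one_add_one_eq_two, Complex.I_sq, neg_one_mul, Complex.neg_im, spinForm_gammaMap_im]
    simp

variable {φ}

lemma IsDiracCurrent.metric_frame {V : ∀ x : M, TangentSpace (𝓡 (m + 1)) x}
    (hV : φ.IsDiracCurrent V) {i : ι} {x : M} (hx : x ∈ S.U i) (a : Fin (m + 1)) :
    g.val x (V x) (S.frame i a x) = -(spinForm (φ.toFun i x) (gamma m a (φ.toFun i x))).re := by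
  have h := congrArg Complex.re (hV i x hx (S.frame i a x))
  rw [Complex.ofReal_re, clifford_frame φ hx] at h
  simpa [one_add_one_eq_two] using h

lemma IsDiracCurrent.eq_sum {V : ∀ x : M, TangentSpace (𝓡 (m + 1)) x}
    (hV : φ.IsDiracCurrent V) {i : ι} {x : M} (hx : x ∈ S.U i) :
    V x = ∑ a, currentComponents (φ.toFun i x) a • S.frame i a x := by
  refine eq_of_metric_frame_eq g (e := fun a => S.frame i a x) (S.orthonormal i x hx) fun a => ?_
  apply Complex.ofReal_injective
  rw [hV i x hx, φ.metric_current]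

variable (φ) in
lemma existsUnique_isDiracCurrent :
    ∃! V : ∀ x : M, TangentSpace (𝓡 (m + 1)) x, φ.IsDiracCurrent V := by
  -- The trivialisation is chosen point by point, with no continuity in the choice; smoothness is
  -- recovered later from the local formula.
  choose k hk using S.exists_mem_U
  refine ⟨fun x => ∑ a, currentComponents (φ.toFun (k x) x) a • S.frame (k x) a x, ?_, ?_⟩
  · intro i x hx X
    rw [φ.metric_current, φ.spinForm_clifford_compatible ⟨hk x, hx⟩]
  · intro W hW
    funext x
    exact hW.eq_sum (hk x)

lemma IsDiracCurrent.components_eq {V : ∀ x : M, TangentSpace (𝓡 (m + 1)) x}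
    (hV : φ.IsDiracCurrent V) {i : ι} {x : M} (hx : x ∈ S.U i) :
    components g (fun a => S.frame i a x) (V x) = currentComponents (φ.toFun i x) := by
  rw [hV.eq_sum hx, components_sum_smul g (e := fun a => S.frame i a x) (S.orthonormal i x hx)]

/-- The Dirac current is causal. -/
lemma IsDiracCurrent.metric_self_nonpos {V : ∀ x : M, TangentSpace (𝓡 (m + 1)) x}
    (hV : φ.IsDiracCurrent V) (x : M) : g.val x (V x) (V x) ≤ 0 := by
  obtain ⟨i, hx⟩ := S.exists_mem_U x
  have h : g.val x (V x) (V x) = ∑ a, sgn a * currentComponents (φ.toFun i x) a ^ 2 := by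
    conv_lhs => rw [hV.eq_sum hx, metric_sum_smul_left, ← hV.eq_sum hx]
    refine Finset.sum_congr rfl fun a _ => ?_
    rw [g.symm, hV.metric_frame hx, currentComponents]
    linear_combination -(sgn a * (spinForm (φ.toFun i x) (gamma m a (φ.toFun i x))).re ^ 2) *
      sgn_mul_sgn a
  rw [h]
  exact sum_sgn_mul_sq_nonpos _ _ fun a => rfl

/-- The Dirac current vanishes only where the spinor does. -/
lemma IsDiracCurrent.ne_zero_of_ne_zero {V : ∀ x : M, TangentSpace (𝓡 (m + 1)) x}
    (hV : φ.IsDiracCurrent V) {i : ι} {x : M} (hx : x ∈ S.U i) (h0 : φ.toFun i x ≠ 0) :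
    V x ≠ 0 := by
  intro hVx
  have h := congrFun (hV.components_eq hx) 0
  rw [hVx, currentComponents_zero] at h
  refine h0 (norm_eq_zero.1 (pow_eq_zero_iff two_ne_zero |>.1 ?_))
  rw [← h]
  simp [components]

end SpinorField

end

section

/-! ### The spin connection form -/

/-- The endomorphism `(1/4) ∑ θ_{ac} γ_a γ_c` of the spinor module. -/
def spinConnection {m : ℕ} (θ : Fin (m + 1) → Fin (m + 1) → ℝ) : Module.End ℂ (Spinor m) :=
  (1 / 4 : ℝ) • ∑ a, ∑ c, θ a c • (gamma m a * gamma m c)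

lemma spinConnection_apply {m : ℕ} (θ : Fin (m + 1) → Fin (m + 1) → ℝ) (u : Spinor m) :
    spinConnection θ u = (1 / 4 : ℝ) • ∑ a, ∑ c, θ a c • gamma m a (gamma m c u) := by
  simp [spinConnection, LinearMap.sum_apply]

lemma gamma_mul_add_gamma_mul {m : ℕ} (a c : Fin (m + 1)) :
    gamma m a * gamma m c + gamma m c * gamma m a =
      (if a = c then -2 * sgn a else 0 : ℝ) • (1 : Module.End ℂ (Spinor m)) := by
  split_ifs with h
  · subst h
    rw [gamma_sq, Algebra.algebraMap_eq_smul_one, ← add_smul]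
    congr 1
    ring
  · rw [gamma_anticomm m h, zero_smul]

/-- From [γ_c, γ_a γ_d] = {γ_c, γ_a}γ_d - γ_a{γ_c, γ_d}. Each anticommutator gives a factor -2ε_c,
and antisymmetry of θ makes the two sums equal, which absorbs the 1/4. -/
lemma gamma_mul_spinConnection_sub {m : ℕ} {θ : Fin (m + 1) → Fin (m + 1) → ℝ}
    (hθ : ∀ a c, θ a c = -θ c a) (c : Fin (m + 1)) :
    gamma m c * spinConnection θ - spinConnection θ * gamma m c =
      ∑ d, (-(sgn c * θ c d)) • gamma m d := by
  have hcomm (a d : Fin (m + 1)) : gamma m c * (gamma m a * gamma m d) -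
      gamma m a * gamma m d * gamma m c =
      (if c = a then -2 * sgn c else 0 : ℝ) • gamma m d -
        (if c = d then -2 * sgn c else 0 : ℝ) • gamma m a := by
    have h1 := congrArg (· * gamma m d) (gamma_mul_add_gamma_mul c a)
    have h2 := congrArg (gamma m a * ·) (gamma_mul_add_gamma_mul c d)
    simp only [smul_mul_assoc, one_mul, mul_smul_comm, mul_one] at h1 h2
    rw [← h1, ← h2]
    noncomm_ring
  have h : gamma m c * spinConnection θ - spinConnection θ * gamma m c =
      (1 / 4 : ℝ) • ∑ a, ∑ d, θ a d • (gamma m c * (gamma m a * gamma m d) -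
        gamma m a * gamma m d * gamma m c) := by
    simp only [spinConnection, mul_smul_comm, smul_mul_assoc, Finset.mul_sum, Finset.sum_mul,
      smul_sub, Finset.sum_sub_distrib]
  rw [h]
  simp only [hcomm, smul_sub, Finset.sum_sub_distrib, smul_smul]
  rw [Finset.sum_comm (f := fun a d => (θ a d * if c = a then -2 * sgn c else 0) • gamma m d)]
  simp only [mul_ite, mul_zero, ite_smul, zero_smul, Finset.sum_ite_eq, Finset.mem_univ, if_true,
    Finset.smul_sum, ← Finset.sum_sub_distrib, smul_smul, ← sub_smul]
  refine Finset.sum_congr rfl fun d _ => ?_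
  rw [hθ d c]
  congr 1
  ring

/-- The adjoint of γ_a γ_c is γ_c γ_a, and exchanging the indices of θ costs a sign. -/
lemma spinForm_spinConnection_left {m : ℕ} {θ : Fin (m + 1) → Fin (m + 1) → ℝ}
    (hθ : ∀ a c, θ a c = -θ c a) (u v : Spinor m) :
    spinForm (spinConnection θ u) v = -spinForm u (spinConnection θ v) := by
  simp only [spinConnection_apply, spinForm_smul_left, spinForm_smul_right, spinForm_sum_left,
    spinForm_sum_right, spinForm_gamma_left]
  rw [Finset.sum_comm, ← mul_neg, ← Finset.sum_neg_distrib]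
  congr 1
  refine Finset.sum_congr rfl fun a _ => ?_
  rw [← Finset.sum_neg_distrib]
  refine Finset.sum_congr rfl fun c _ => ?_
  rw [hθ c a, Complex.ofReal_neg, neg_mul]

/-- The infinitesimal equivariance of the current under the spin connection form. -/
lemma spinForm_spinConnection_gamma {m : ℕ} {θ : Fin (m + 1) → Fin (m + 1) → ℝ}
    (hθ : ∀ a c, θ a c = -θ c a) (c : Fin (m + 1)) (u : Spinor m) :
    spinForm (spinConnection θ u) (gamma m c u) + spinForm u (gamma m c (spinConnection θ u)) =
      ∑ d, ((-(sgn c * θ c d) : ℝ) : ℂ) * spinForm u (gamma m d u) := by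
  have h := LinearMap.congr_fun (gamma_mul_spinConnection_sub hθ c) u
  simp only [LinearMap.sub_apply, Module.End.mul_apply, LinearMap.sum_apply,
    LinearMap.smul_apply] at h
  rw [sub_eq_iff_eq_add'] at h
  rw [h, spinForm_add_right, spinForm_spinConnection_left hθ, neg_add_cancel_left,
    spinForm_sum_right]
  simp only [spinForm_smul_right]

lemma hasFDerivAt_spinForm_gamma {m : ℕ} (a : Fin (m + 1)) (u : Spinor m) :
    ∃ L : Spinor m →L[ℝ] ℝ, HasFDerivAt (fun w => (spinForm w (gamma m a w)).re) L u ∧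
      ∀ v, L v = (spinForm v (gamma m a u) + spinForm u (gamma m a v)).re := by
  let G (c : Fin (m + 1)) : Spinor m →L[ℝ] Spinor m :=
    ((gamma m c).restrictScalars ℝ).toContinuousLinearMap
  have h := ((G a).hasFDerivAt (x := u)).inner ℂ ((G 0).hasFDerivAt (x := u))
  refine ⟨_, Complex.reCLM.hasFDerivAt.comp u h, fun v => ?_⟩
  simp [spinForm, G]

lemma contDiff_spinForm_gamma {m : ℕ} (a : Fin (m + 1)) :
    ContDiff ℝ ∞ (fun w : Spinor m => (spinForm w (gamma m a w)).re) := by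
  let G (c : Fin (m + 1)) : Spinor m →L[ℝ] Spinor m :=
    ((gamma m c).restrictScalars ℝ).toContinuousLinearMap
  exact Complex.reCLM.contDiff.comp ((G a).contDiff.inner ℂ (G 0).contDiff)

section MFDeriv

variable {E H M F G : Type*} [NormedAddCommGroup E] [NormedSpace ℝ E] [TopologicalSpace H]
  {I : ModelWithCorners ℝ E H} [TopologicalSpace M] [ChartedSpace H M]
  [NormedAddCommGroup F] [NormedSpace ℝ F] [NormedAddCommGroup G] [NormedSpace ℝ G]

lemma mvfderiv_comp_of_hasFDerivAt {f : M → F} {q : F → G} {L : F →L[ℝ] G} {x : M}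
    (hq : HasFDerivAt q L (f x)) (hf : MDifferentiableAt I 𝓘(ℝ, F) f x) (X : TangentSpace I x) :
    mvfderiv I (fun y => q (f y)) x X = L (mvfderiv I f x X) := by
  have h := (HasMFDerivAt.comp x hq.hasMFDerivAt hf.hasMFDerivAt).mfderiv
  exact DFunLike.congr_fun h X

lemma mvfderiv_congr_of_eventuallyEq {f f' : M → F} {x : M} (h : f =ᶠ[nhds x] f')
    (X : TangentSpace I x) : mvfderiv I f x X = mvfderiv I f' x X :=
  DFunLike.congr_fun (h.mfderiv_eq (I := I) (I' := 𝓘(ℝ, F))) X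

end MFDeriv

variable {m : ℕ} {M : Type*} [TopologicalSpace M]
  [ChartedSpace (EuclideanSpace ℝ (Fin (m + 1))) M] [IsManifold (𝓡 (m + 1)) ∞ M]
  {g : LorentzianMetric m M} {ι : Type*}

namespace SpinStructure

variable (S : SpinStructure g ι)

lemma U_mem_nhds {i : ι} {x : M} (hx : x ∈ S.U i) : S.U i ∈ nhds x := (S.isOpen_U i).mem_nhds hx

lemma contMDiffAt_frame {i : ι} {x : M} (hx : x ∈ S.U i) (a : Fin (m + 1)) :
    ContMDiffAt (𝓡 (m + 1)) (𝓡 (m + 1)).tangent ∞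
      (fun y => (⟨y, S.frame i a y⟩ : TangentBundle (𝓡 (m + 1)) M)) x :=
  (S.contMDiffOn_frame i a).contMDiffAt (S.U_mem_nhds hx)

lemma mdifferentiableAt_frame {i : ι} {x : M} (hx : x ∈ S.U i) (a : Fin (m + 1)) :
    MDifferentiableAt (𝓡 (m + 1)) (𝓡 (m + 1)).tangent
      (fun y => (⟨y, S.frame i a y⟩ : TangentBundle (𝓡 (m + 1)) M)) x :=
  (S.contMDiffAt_frame hx a).mdifferentiableAt (by simp)

/-- The connection form `ε_a ε_c g(∇_X e_a, e_c)` of a connection in the frame `i`. -/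
def connectionForm (nabla : Connection m M) (i : ι) (x : M) (X : TangentSpace (𝓡 (m + 1)) x)
    (a c : Fin (m + 1)) : ℝ :=
  sgn a * sgn c * g.val x (nabla (S.frame i a) x X) (S.frame i c x)

/-- The products of frame vectors are constant near `x`, so metric compatibility differentiates them
to zero. -/
lemma metric_nabla_frame_antisymm {nabla : Connection m M} (hnabla : IsLeviCivita g nabla)
    {i : ι} {x : M} (hx : x ∈ S.U i) (X : TangentSpace (𝓡 (m + 1)) x) (a c : Fin (m + 1)) :
    g.val x (nabla (S.frame i a) x X) (S.frame i c x) =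
      -g.val x (nabla (S.frame i c) x X) (S.frame i a x) := by
  have h := hnabla.metric _ _ x (S.mdifferentiableAt_frame hx a) (S.mdifferentiableAt_frame hx c) X
  have hc : (fun y => g.val y (S.frame i a y) (S.frame i c y)) =ᶠ[nhds x]
      fun _ => if a = c then sgn a else 0 :=
    Filter.eventually_of_mem (S.U_mem_nhds hx) fun y hy => S.orthonormal i y hy a c
  rw [mvfderiv_congr_of_eventuallyEq hc, mvfderiv_const] at h
  rw [g.symm x (nabla (S.frame i c) x X)]
  exact eq_neg_of_add_eq_zero_left h.symm

lemma connectionForm_antisymm {nabla : Connection m M} (hnabla : IsLeviCivita g nabla)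
    {i : ι} {x : M} (hx : x ∈ S.U i) (X : TangentSpace (𝓡 (m + 1)) x) (a c : Fin (m + 1)) :
    S.connectionForm nabla i x X a c = -S.connectionForm nabla i x X c a := by
  rw [connectionForm, connectionForm, S.metric_nabla_frame_antisymm hnabla hx]
  ring

end SpinStructure

/-! ### Smoothness and parallelism of the Dirac current -/

namespace SpinorField

variable {S : SpinStructure g ι} {φ : SpinorField S}

variable (φ) in
lemma mdifferentiableAt {i : ι} {x : M} (hx : x ∈ S.U i) :
    MDifferentiableAt (𝓡 (m + 1)) 𝓘(ℝ, Spinor m) (φ.toFun i) x :=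
  ((φ.contMDiffOn i).contMDiffAt (S.U_mem_nhds hx)).mdifferentiableAt (by simp)

lemma IsParallel.mvfderiv_eq {nabla : Connection m M} (hφ : φ.IsParallel nabla) {i : ι} {x : M}
    (hx : x ∈ S.U i) (X : TangentSpace (𝓡 (m + 1)) x) :
    mvfderiv (𝓡 (m + 1)) (φ.toFun i) x X =
      -spinConnection (S.connectionForm nabla i x X) (φ.toFun i x) := by
  rw [spinConnection_apply]
  exact eq_neg_of_add_eq_zero_left (hφ i x hx X)

/-- The Dirac current is smooth. -/
lemma IsDiracCurrent.contMDiff {V : ∀ x : M, TangentSpace (𝓡 (m + 1)) x}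
    (hV : φ.IsDiracCurrent V) :
    ContMDiff (𝓡 (m + 1)) (𝓡 (m + 1)).tangent ∞
      (fun x => (⟨x, V x⟩ : TangentBundle (𝓡 (m + 1)) M)) := by
  intro x
  obtain ⟨i, hx⟩ := S.exists_mem_U x
  have hsum : ContMDiffAt (𝓡 (m + 1)) (𝓡 (m + 1)).tangent ∞
      (fun y => (⟨y, ∑ a, currentComponents (φ.toFun i y) a • S.frame i a y⟩ :
        TangentBundle (𝓡 (m + 1)) M)) x := by
    refine ContMDiffAt.sum_section fun a _ => ?_
    refine ContMDiffAt.smul_section (f := fun y => currentComponents (φ.toFun i y) a) ?_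
      (S.contMDiffAt_frame hx a)
    have hq : ContDiff ℝ ∞ (fun u : Spinor m => currentComponents u a) :=
      ((contDiff_spinForm_gamma a).const_smul (sgn a)).neg
    exact hq.contMDiff.contMDiffAt.comp x ((φ.contMDiffOn i).contMDiffAt (S.U_mem_nhds hx))
  refine hsum.congr_of_eventuallyEq ?_
  filter_upwards [S.U_mem_nhds hx] with y hy
  rw [hV.eq_sum hy]

/-- The Dirac current of a parallel spinor field is parallel. -/
lemma IsDiracCurrent.nabla_eq_zero {nabla : Connection m M} (hnabla : IsLeviCivita g nabla)
    (hφ : φ.IsParallel nabla) {V : ∀ x : M, TangentSpace (𝓡 (m + 1)) x}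
    (hV : φ.IsDiracCurrent V) (x : M) (X : TangentSpace (𝓡 (m + 1)) x) : nabla V x X = 0 := by
  obtain ⟨i, hx⟩ := S.exists_mem_U x
  refine eq_of_metric_frame_eq g (e := fun a => S.frame i a x) (S.orthonormal i x hx) fun c => ?_
  have hmet := hnabla.metric V (S.frame i c) x
    (hV.contMDiff.contMDiffAt.mdifferentiableAt (by simp)) (S.mdifferentiableAt_frame hx c) X
  obtain ⟨L, hL, hLv⟩ := hasFDerivAt_spinForm_gamma c (φ.toFun i x)
  have hloc : (fun y => g.val y (V y) (S.frame i c y)) =ᶠ[nhds x]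
      fun y => -(spinForm (φ.toFun i y) (gamma m c (φ.toFun i y))).re :=
    Filter.eventually_of_mem (S.U_mem_nhds hx) fun y hy => hV.metric_frame hy c
  rw [mvfderiv_congr_of_eventuallyEq hloc,
    mvfderiv_comp_of_hasFDerivAt (q := fun w => -(spinForm w (gamma m c w)).re) hL.neg
      (φ.mdifferentiableAt hx), hφ.mvfderiv_eq hx, neg_apply, map_neg, neg_neg,
    hLv, spinForm_spinConnection_gamma (S.connectionForm_antisymm hnabla hx X)] at hmet
  -- This sum is also the derivative of g(V, e_c) computed from the spinor, so metric compatibility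
  -- leaves nothing for g(∇_X V, e_c).
  have hVc : g.val x (V x) (nabla (S.frame i c) x X) =
      ∑ d, -(sgn c * S.connectionForm nabla i x X c d) *
        (spinForm (φ.toFun i x) (gamma m d (φ.toFun i x))).re := by
    rw [hV.eq_sum hx, metric_sum_smul_left]
    refine Finset.sum_congr rfl fun d _ => ?_
    rw [currentComponents, SpinStructure.connectionForm, g.symm]
    linear_combination sgn d * g.val x (nabla (S.frame i c) x X) (S.frame i d x) *
      (spinForm (φ.toFun i x) (gamma m d (φ.toFun i x))).re * sgn_mul_sgn c
  simp only [Complex.re_sum, Complex.re_ofReal_mul] at hmet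
  rw [hVc] at hmet
  simpa using hmet

end SpinorField

end

section

/-! ### Unique continuation for functions with `‖df‖ ≤ C ‖f‖` -/

section UniqueContinuation

open Filter Topology

/-- On a closed ball of radius at most 1/(2D), let ‖F‖ be maximal at z. The mean value inequality
gives ‖F z‖ ≤ D‖F z‖‖z - x‖ ≤ ‖F z‖/2, so the maximum is zero. -/
lemma eventually_eq_zero_of_norm_fderiv_le {E G : Type*} [NormedAddCommGroup E] [NormedSpace ℝ E]
    [FiniteDimensional ℝ E] [NormedAddCommGroup G] [NormedSpace ℝ G] {F : E → G} {x : E} {C : ℝ}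
    (h0 : F x = 0) (hF : ∀ᶠ y in 𝓝 x, DifferentiableAt ℝ F y ∧ ‖fderiv ℝ F y‖ ≤ C * ‖F y‖) :
    ∀ᶠ y in 𝓝 x, F y = 0 := by
  obtain ⟨r, hr, hball⟩ := Metric.eventually_nhds_iff_ball.1 hF
  set D : ℝ := max C 1 with hD
  have hD0 : 0 < D := lt_of_lt_of_le one_pos (le_max_right _ _)
  set ρ : ℝ := min (r / 2) (1 / (2 * D)) with hρ
  have hρ0 : 0 < ρ := by positivity
  have hsub : Metric.closedBall x ρ ⊆ Metric.ball x r :=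
    Metric.closedBall_subset_ball (lt_of_le_of_lt (min_le_left _ _) (by linarith))
  have hcont : ContinuousOn (fun y => ‖F y‖) (Metric.closedBall x ρ) := fun y hy =>
    (hball y (hsub hy)).1.continuousAt.norm.continuousWithinAt
  have := FiniteDimensional.proper ℝ E
  obtain ⟨z, hz, hmax⟩ := (isCompact_closedBall x ρ).exists_isMaxOn
    ⟨x, Metric.mem_closedBall_self hρ0.le⟩ hcont
  have hbound : ‖F z - F x‖ ≤ (D * ‖F z‖) * ‖z - x‖ := by
    refine (convex_closedBall x ρ).norm_image_sub_le_of_norm_fderiv_le (𝕜 := ℝ)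
      (fun y hy => (hball y (hsub hy)).1) (fun y hy => ?_) (Metric.mem_closedBall_self hρ0.le) hz
    calc ‖fderiv ℝ F y‖ ≤ C * ‖F y‖ := (hball y (hsub hy)).2
      _ ≤ D * ‖F y‖ := by gcongr; exact le_max_left _ _
      _ ≤ D * ‖F z‖ := by gcongr; exact hmax hy
  have hz0 : ‖F z‖ = 0 := by
    have h1 : ‖z - x‖ ≤ 1 / (2 * D) := (mem_closedBall_iff_norm.1 hz).trans (min_le_right _ _)
    rw [h0, sub_zero] at hbound
    have h2 : (D * ‖F z‖) * ‖z - x‖ ≤ (D * ‖F z‖) * (1 / (2 * D)) := by gcongr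
    have h3 : (D * ‖F z‖) * (1 / (2 * D)) = ‖F z‖ / 2 := by field_simp
    linarith [norm_nonneg (F z)]
  filter_upwards [Metric.closedBall_mem_nhds x hρ0] with y hy
  exact norm_le_zero_iff.1 ((hmax hy).trans_eq hz0)

lemma ContinuousLinearMap.norm_le_sum_basis {n : ℕ} {G : Type*} [NormedAddCommGroup G]
    [NormedSpace ℝ G] (L : EuclideanSpace ℝ (Fin n) →L[ℝ] G) :
    ‖L‖ ≤ ∑ k, ‖L (EuclideanSpace.basisFun (Fin n) ℝ k)‖ := by
  refine L.opNorm_le_bound (Finset.sum_nonneg fun _ _ => norm_nonneg _) fun v => ?_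
  conv_lhs => rw [← (EuclideanSpace.basisFun (Fin n) ℝ).sum_repr v, map_sum]
  rw [Finset.sum_mul]
  refine (norm_sum_le _ _).trans (Finset.sum_le_sum fun k _ => ?_)
  rw [map_smul, norm_smul, mul_comm]
  gcongr
  simpa using PiLp.norm_apply_le v k

/-- A function on a manifold that vanishes at `x` vanishes near `x` if its derivatives along smooth
vector fields are locally bounded by multiples of its norm. -/
lemma eventually_eq_zero_of_norm_mvfderiv_le {n : ℕ} {M : Type*} [TopologicalSpace M]
    [ChartedSpace (EuclideanSpace ℝ (Fin n)) M] [IsManifold (𝓡 n) ∞ M]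
    {G : Type*} [NormedAddCommGroup G] [NormedSpace ℝ G] {f : M → G} {x : M} (h0 : f x = 0)
    (hf : ∀ᶠ y in 𝓝 x, MDifferentiableAt (𝓡 n) 𝓘(ℝ, G) f y)
    (hbound : ∀ X : ∀ y : M, TangentSpace (𝓡 n) y,
      ContMDiffAt (𝓡 n) (𝓡 n).tangent ∞ (fun y => (⟨y, X y⟩ : TangentBundle (𝓡 n) M)) x →
      ∃ C : ℝ, ∀ᶠ y in 𝓝 x, ‖mvfderiv (𝓡 n) f y (X y)‖ ≤ C * ‖f y‖) :
    ∀ᶠ y in 𝓝 x, f y = 0 := by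
  have : IsManifold (𝓡 n) 1 M := IsManifold.of_le (n := ∞) (by simp)
  set T := trivializationAt (EuclideanSpace ℝ (Fin n)) (TangentSpace (𝓡 n) : M → Type _) x
  set b := (EuclideanSpace.basisFun (Fin n) ℝ).toBasis
  have hX (k : Fin n) : ∃ C : ℝ, ∀ᶠ y in 𝓝 x,
      ‖mvfderiv (𝓡 n) f y (T.symmL ℝ y (b k))‖ ≤ C * ‖f y‖ := by
    refine hbound (fun y => T.symmL ℝ y (b k)) ?_
    have h := (T.contMDiffOn_section_baseSet_iff (IB := 𝓡 n) (n := ∞)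
      (s := fun y => T.symmL ℝ y (b k))).2
      ((contMDiffOn_const (c := b k)).congr fun y hy => by
        rw [T.symmL_apply hy, T.apply_mk_symm hy])
    exact h.contMDiffAt (T.open_baseSet.mem_nhds
      (FiberBundle.mem_baseSet_trivializationAt' x))
  choose C hC using hX
  set ψ := extChartAt (𝓡 n) x
  have hψ : Tendsto ψ.symm (𝓝 (ψ x)) (𝓝 x) := by
    have := (continuousAt_extChartAt_symm (I := 𝓡 n) x).tendsto
    rwa [extChartAt_to_inv] at this
  have htarget : ∀ᶠ u in 𝓝 (ψ x), u ∈ ψ.target := extChartAt_target_mem_nhds (I := 𝓡 n) x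
  have key : ∀ᶠ u in 𝓝 (ψ x), (f ∘ ψ.symm) u = 0 := by
    refine eventually_eq_zero_of_norm_fderiv_le (C := ∑ k, C k) ?_ ?_
    · simp [ψ, h0]
    · filter_upwards [htarget, hψ.eventually hf, hψ.eventually (eventually_all.2 hC)]
        with u hu hfu hCu
      have hsource : ψ.symm u ∈ (chartAt (EuclideanSpace ℝ (Fin n)) x).source := by
        simpa [ψ] using ψ.map_target hu
      have hsymm : MDifferentiableAt 𝓘(ℝ, EuclideanSpace ℝ (Fin n)) (𝓡 n) ψ.symm u := by
        have := (contMDiffOn_extChartAt_symm (I := 𝓡 n) (n := 1) x).contMDiffAt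
          ((isOpen_extChartAt_target (I := 𝓡 n) x).mem_nhds hu)
        exact this.mdifferentiableAt one_ne_zero
      have hcomp := HasMFDerivAt.comp u hfu.hasMFDerivAt hsymm.hasMFDerivAt
      -- The inverse tangent trivialisation is the derivative of the inverse chart, so the partial
      -- derivatives of `f` in the chart are its derivatives along the fields bounded by `hC`.
      have hd : HasFDerivAt (f ∘ ψ.symm) ((mvfderiv (𝓡 n) f (ψ.symm u)).comp
          (T.symmL ℝ (ψ.symm u))) u := by
        rw [TangentBundle.symmL_trivializationAt hsource]
        simp only [modelWithCornersSelf_coe, Set.range_id, mfderivWithin_univ]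
        rw [ψ.right_inv hu]
        exact hasMFDerivAt_iff_hasFDerivAt.1 hcomp
      refine ⟨hd.differentiableAt, ?_⟩
      rw [hd.fderiv, Finset.sum_mul]
      refine (ContinuousLinearMap.norm_le_sum_basis _).trans (Finset.sum_le_sum fun k _ => ?_)
      simpa [b] using hCu k
  have hψx : Tendsto ψ (𝓝 x) (𝓝 (ψ x)) := (continuousAt_extChartAt (I := 𝓡 n) x).tendsto
  filter_upwards [hψx.eventually key, extChartAt_source_mem_nhds (I := 𝓡 n) x] with y hy hys
  rwa [Function.comp_apply, ψ.left_inv hys] at hy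

end UniqueContinuation

end

section

variable {m : ℕ} {M : Type*} [TopologicalSpace M]
  [ChartedSpace (EuclideanSpace ℝ (Fin (m + 1))) M] [IsManifold (𝓡 (m + 1)) ∞ M]
  {g : LorentzianMetric m M} {ι : Type*}

/-! ### Local bounds for the connection form and nowhere vanishing parallel spinors -/

open Filter Topology

lemma continuousAt_metric {Y Z : ∀ x : M, TangentSpace (𝓡 (m + 1)) x} {x : M}
    (hY : ContMDiffAt (𝓡 (m + 1)) (𝓡 (m + 1)).tangent 0
      (fun y => (⟨y, Y y⟩ : TangentBundle (𝓡 (m + 1)) M)) x)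
    (hZ : ContMDiffAt (𝓡 (m + 1)) (𝓡 (m + 1)).tangent 0
      (fun y => (⟨y, Z y⟩ : TangentBundle (𝓡 (m + 1)) M)) x) :
    ContinuousAt (fun y => g.val y (Y y) (Z y)) x := by
  have h : ContMDiffAt (𝓡 (m + 1)) ((𝓡 (m + 1)).prod 𝓘(ℝ, ℝ)) 0
      (fun y => (⟨y, g.val y (Y y) (Z y)⟩ : Bundle.TotalSpace ℝ (Bundle.Trivial M ℝ))) x :=
    ContMDiffAt.clm_bundle_apply₂ (F₁ := EuclideanSpace ℝ (Fin (m + 1)))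
      (F₂ := EuclideanSpace ℝ (Fin (m + 1))) ((g.contMDiff x).of_le (by simp)) hY hZ
  simp only [Bundle.contMDiffAt_totalSpace] at h
  exact h.2.continuousAt

namespace SpinStructure

variable (S : SpinStructure g ι)

/-- Koszul's formula for an orthonormal frame. -/
lemma two_mul_metric_nabla_frame {nabla : Connection m M} (hnabla : IsLeviCivita g nabla)
    {i : ι} {x : M} (hx : x ∈ S.U i) (a b c : Fin (m + 1)) :
    2 * g.val x (nabla (S.frame i a) x (S.frame i b x)) (S.frame i c x) =
      g.val x (VectorField.mlieBracket (𝓡 (m + 1)) (S.frame i b) (S.frame i a) x) (S.frame i c x) -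
      g.val x (VectorField.mlieBracket (𝓡 (m + 1)) (S.frame i a) (S.frame i c) x) (S.frame i b x) +
      g.val x (VectorField.mlieBracket (𝓡 (m + 1)) (S.frame i c) (S.frame i b) x)
        (S.frame i a x) := by
  have : IsManifold (𝓡 (m + 1)) 2 M := IsManifold.of_le (n := ∞) (by norm_cast)
  have hT (p q : Fin (m + 1)) := (nabla.torsion_eq_zero_iff.1 hnabla.torsion_eq_zero
    (S.mdifferentiableAt_frame hx p) (S.mdifferentiableAt_frame hx q)).symm
  have hA (p q r : Fin (m + 1)) :=
    S.metric_nabla_frame_antisymm hnabla hx (S.frame i p x) q r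
  -- Brackets become differences of covariant derivatives. Three antisymmetry relations cancel the
  -- rest; no derivatives of the metric appear, as the frame is orthonormal.
  rw [hT, hT, hT]
  simp only [map_sub, sub_apply]
  linear_combination hA a c b + hA b a c - hA c a b

/-- Continuity is derived, not assumed of `nabla`: Koszul's formula expresses the coefficients
through brackets of smooth fields. -/
lemma continuousAt_metric_nabla_frame {nabla : Connection m M} (hnabla : IsLeviCivita g nabla)
    {i : ι} {x : M} (hx : x ∈ S.U i) (a b c : Fin (m + 1)) :
    ContinuousAt (fun y => g.val y (nabla (S.frame i a) y (S.frame i b y)) (S.frame i c y)) x := by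
  have hb (p q r : Fin (m + 1)) : ContinuousAt (fun y => g.val y
      (VectorField.mlieBracket (𝓡 (m + 1)) (S.frame i p) (S.frame i q) y) (S.frame i r y)) x := by
    refine continuousAt_metric ?_ ((S.contMDiffAt_frame hx r).of_le (by simp))
    have : IsManifold (𝓡 (m + 1)) (((⊤ : ℕ∞) : WithTop ℕ∞) + 1) M := by simpa
    have : IsManifold (𝓡 (m + 1)) (minSmoothness ℝ 2) M := by
      simpa using IsManifold.of_le (n := ∞) (by norm_cast)
    exact ContMDiffAt.mlieBracket_vectorField (m := 0) (n := ⊤) (S.contMDiffAt_frame hx p)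
      (S.contMDiffAt_frame hx q) (by simp)
  have h := (((hb b a c).sub (hb a c b)).add (hb c b a)).const_mul (1 / 2)
  refine h.congr ?_
  filter_upwards [S.U_mem_nhds hx] with y hy
  have := S.two_mul_metric_nabla_frame hnabla hy a b c
  simp only [Pi.add_apply, Pi.sub_apply]
  rw [← this]
  ring

lemma exists_abs_connectionForm_le {nabla : Connection m M} (hnabla : IsLeviCivita g nabla)
    {i : ι} {x : M} (hx : x ∈ S.U i) {X : ∀ y : M, TangentSpace (𝓡 (m + 1)) y}
    (hX : ContMDiffAt (𝓡 (m + 1)) (𝓡 (m + 1)).tangent ∞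
      (fun y => (⟨y, X y⟩ : TangentBundle (𝓡 (m + 1)) M)) x) :
    ∃ C : ℝ, ∀ᶠ y in 𝓝 x, ∀ a c, |S.connectionForm nabla i y (X y) a c| ≤ C := by
  have hcont (a c : Fin (m + 1)) :
      ContinuousAt (fun y => S.connectionForm nabla i y (X y) a c) x := by
    have hcomp (b : Fin (m + 1)) : ContinuousAt
        (fun y => components g (fun d => S.frame i d y) (X y) b) x :=
      (continuousAt_metric (hX.of_le (by simp))
        ((S.contMDiffAt_frame hx b).of_le (by simp))).const_mul (sgn b)
    have hsum : ContinuousAt (fun y => sgn a * sgn c *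
        ∑ b, components g (fun d => S.frame i d y) (X y) b *
          g.val y (nabla (S.frame i a) y (S.frame i b y)) (S.frame i c y)) x :=
      (tendsto_finsetSum _ fun b _ =>
        (hcomp b).mul (S.continuousAt_metric_nabla_frame hnabla hx a b c)).const_mul _
    refine hsum.congr ?_
    filter_upwards [S.U_mem_nhds hx] with y hy
    rw [connectionForm]
    conv_rhs => rw [← sum_components_smul g (e := fun d => S.frame i d y) (S.orthonormal i y hy)
      (X y)]
    simp only [map_sum, map_smul, sum_apply, smul_apply, smul_eq_mul]
  -- Summing the bounds for the finitely many entries gives one constant that dominates each.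
  refine ⟨∑ a, ∑ c, (|S.connectionForm nabla i x (X x) a c| + 1), ?_⟩
  have hev : ∀ᶠ y in 𝓝 x, ∀ a c, |S.connectionForm nabla i y (X y) a c| <
      |S.connectionForm nabla i x (X x) a c| + 1 :=
    eventually_all.2 fun a => eventually_all.2 fun c =>
      (hcont a c).abs.eventually_lt continuousAt_const (lt_add_one _)
  filter_upwards [hev] with y hy a c
  refine (hy a c).le.trans ?_
  refine (Finset.single_le_sum (f := fun c => |S.connectionForm nabla i x (X x) a c| + 1)
    (fun _ _ => by positivity) (Finset.mem_univ c)).trans ?_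
  exact Finset.single_le_sum (f := fun a => ∑ c, (|S.connectionForm nabla i x (X x) a c| + 1))
    (fun _ _ => by positivity) (Finset.mem_univ a)

end SpinStructure

lemma norm_gamma {m : ℕ} (a : Fin (m + 1)) (u : Spinor m) : ‖gamma m a u‖ = ‖u‖ := by
  by_cases ha : a = 0
  · rw [ha, norm_gamma_zero]
  · have h := norm_gammaMap_sq (v := Pi.single a 1) (Pi.single_eq_of_ne (Ne.symm ha) _) u
    rw [gammaMap_single] at h
    have h1 : ∑ c, (Pi.single a 1 : Fin (m + 1) → ℝ) c ^ 2 = 1 := by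
      simp [Pi.single_apply, ite_pow]
    rw [h1, one_mul] at h
    exact (sq_eq_sq₀ (norm_nonneg _) (norm_nonneg _)).1 h

lemma norm_spinConnection_le {m : ℕ} {θ : Fin (m + 1) → Fin (m + 1) → ℝ} {C : ℝ}
    (hθ : ∀ a c, |θ a c| ≤ C) (u : Spinor m) :
    ‖spinConnection θ u‖ ≤ ((1 / 4) * ∑ _a : Fin (m + 1), ∑ _c : Fin (m + 1), C) * ‖u‖ := by
  rw [spinConnection_apply, norm_smul, mul_assoc, Finset.sum_mul, Real.norm_of_nonneg (by norm_num)]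
  refine mul_le_mul_of_nonneg_left ((norm_sum_le _ _).trans (Finset.sum_le_sum fun a _ => ?_))
    (by norm_num)
  rw [Finset.sum_mul]
  refine (norm_sum_le _ _).trans (Finset.sum_le_sum fun c _ => ?_)
  rw [norm_smul, norm_gamma, norm_gamma, Real.norm_eq_abs]
  exact mul_le_mul_of_nonneg_right (hθ a c) (norm_nonneg _)

namespace SpinorField

variable {S : SpinStructure g ι} {φ : SpinorField S}

lemma eq_zero_of_eq_zero {i j : ι} {x : M} (hx : x ∈ S.U i ∩ S.U j) (h : φ.toFun j x = 0) :
    φ.toFun i x = 0 := by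
  rw [φ.compatible i j x hx, h, map_zero]

lemma IsParallel.eventually_eq_zero {nabla : Connection m M} (hnabla : IsLeviCivita g nabla)
    (hφ : φ.IsParallel nabla) {i : ι} {x : M} (hx : x ∈ S.U i) (h0 : φ.toFun i x = 0) :
    ∀ᶠ y in 𝓝 x, φ.toFun i y = 0 := by
  refine eventually_eq_zero_of_norm_mvfderiv_le (n := m + 1) h0 ?_ fun X hX => ?_
  · filter_upwards [S.U_mem_nhds hx] with y hy using φ.mdifferentiableAt hy
  · obtain ⟨C, hC⟩ := S.exists_abs_connectionForm_le hnabla hx hX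
    refine ⟨(1 / 4) * ∑ _a : Fin (m + 1), ∑ _c : Fin (m + 1), C, ?_⟩
    filter_upwards [hC, S.U_mem_nhds hx] with y hCy hy
    rw [hφ.mvfderiv_eq hy, norm_neg]
    exact norm_spinConnection_le hCy _

/-- A nontrivial parallel spinor field on a connected manifold vanishes nowhere. -/
lemma IsParallel.ne_zero [ConnectedSpace M] {nabla : Connection m M}
    (hnabla : IsLeviCivita g nabla) (hφ : φ.IsParallel nabla) (hφ0 : φ.IsNontrivial)
    {i : ι} {x : M} (hx : x ∈ S.U i) : φ.toFun i x ≠ 0 := by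
  -- The zero set of the section: by compatibility, vanishing in one trivialisation forces it in
  -- all. `Z` is open by unique continuation, its complement by continuity.
  set Z : Set M := {y | ∃ j, y ∈ S.U j ∧ φ.toFun j y = 0} with hZ
  have hopen : IsOpen Z := by
    rw [isOpen_iff_mem_nhds]
    rintro y ⟨j, hy, h0⟩
    filter_upwards [hφ.eventually_eq_zero hnabla hy h0, S.U_mem_nhds hy] with z hz hzj
    exact ⟨j, hzj, hz⟩
  have hcompl : IsOpen Zᶜ := by
    rw [isOpen_iff_mem_nhds]
    intro y hy
    obtain ⟨j, hyj⟩ := S.exists_mem_U y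
    have hne : φ.toFun j y ≠ 0 := fun h => hy ⟨j, hyj, h⟩
    filter_upwards [(φ.mdifferentiableAt hyj).continuousAt.eventually_ne hne, S.U_mem_nhds hyj]
      with z hz hzj
    rintro ⟨k, hzk, h0⟩
    exact hz (eq_zero_of_eq_zero ⟨hzj, hzk⟩ h0)
  rcases isClopen_iff.1 ⟨isOpen_compl_iff.1 hcompl, hopen⟩ with h | h
  · intro h0
    have : x ∈ Z := ⟨i, hx, h0⟩
    rw [h] at this
    exact this
  · obtain ⟨j, y, hy, hne⟩ := hφ0
    obtain ⟨k, hyk, h0⟩ : y ∈ Z := h ▸ Set.mem_univ y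
    exact absurd (eq_zero_of_eq_zero ⟨hy, hyk⟩ h0) hne

end SpinorField

end

end SpinLorentz

end

theorem mainTheorem9 {m : ℕ} {M : Type*} [TopologicalSpace M] [T2Space M]
    [SecondCountableTopology M] [ConnectedSpace M]
    [ChartedSpace (EuclideanSpace ℝ (Fin (m + 1))) M] [IsManifold (𝓡 (m + 1)) ∞ M]
    (g : SpinLorentz.LorentzianMetric m M)
    (nabla : SpinLorentz.Connection m M) (hnabla : SpinLorentz.IsLeviCivita g nabla)
    {ι : Type*} (S : SpinLorentz.SpinStructure g ι)
    (φ : SpinLorentz.SpinorField S) (hφ : φ.IsParallel nabla) (hφ0 : φ.IsNontrivial) :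
    (∃! V : ∀ x : M, TangentSpace (𝓡 (m + 1)) x, φ.IsDiracCurrent V) ∧
    ∀ V : ∀ x : M, TangentSpace (𝓡 (m + 1)) x, φ.IsDiracCurrent V →
      ContMDiff (𝓡 (m + 1)) (𝓡 (m + 1)).tangent ∞
        (fun x => (⟨x, V x⟩ : TangentBundle (𝓡 (m + 1)) M)) ∧
      (∀ x, V x ≠ 0) ∧
      (∀ (x : M) (X : TangentSpace (𝓡 (m + 1)) x), nabla V x X = 0) ∧
      (∀ x, g.val x (V x) (V x) ≤ 0) := by
  refine ⟨φ.existsUnique_isDiracCurrent, fun V hV => ⟨hV.contMDiff, fun x => ?_,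
    hV.nabla_eq_zero hnabla hφ, hV.metric_self_nonpos⟩⟩
  obtain ⟨i, hx⟩ := S.exists_mem_U x
  exact hV.ne_zero_of_ne_zero hx (hφ.ne_zero hnabla hφ0 hx)
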